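/- A (finite) schema consists of finitely many relation symbols, each of some finite arity, and finitely many constant symbols; a database $\mathcal{D}$ of the schema over a nonempty finite domain $D$ interprets them by relations over $D$ and by elements of $D$. A modification inserts a tuple over $D$ into, or deletes it from, one of the relations (with no effect if the tuple is already present, respectively absent); for a sequence $\alpha$ of modifications, $\alpha(\mathcal{D})$ is the database obtained from $\mathcal{D}$ by applying the modifications of $\alpha$ one after the other. A DynProp program with unary auxiliary functions over an input schema $\tau_{\mathrm{in}}$ consists of: (i) an auxiliary schema $\tau_{\mathrm{aux}}$ with finitely many relation symbols of arbitrary finite arities and finitely many function symbols of arity at most $1$ (function symbols of arity $0$ are auxiliary constants); (ii) for every $\delta\in\{\mathrm{ins}_S,\mathrm{del}_S\}$, where $S$ is a relation symbol of $\tau_{\mathrm{in}}$: for every relation symbol $R$ of $\tau_{\mathrm{aux}}$ a quantifier-free update formula $\varphi^R_\delta(\vec x;\vec y)$, and for every function symbol $f$ of $\tau_{\mathrm{aux}}$ an update term $t^f_\delta(\vec x;\vec y)$, all over $\tau_{\mathrm{in}}\cup\tau_{\mathrm{aux}}$, where $\vec x$ has the arity of $S$ and $\vec y$ the arity of $R$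 or $f$. Here update terms are built from variables by function and constant symbols and by the if-then-else construct $\mathrm{ite}(\psi,t_1,t_2)$ with a quantifier-free update formula $\psi$, and quantifier-free update formulas are the Boolean combinations of equations and relational atoms between update terms; (iii) an arbitrary mapping $\mathrm{Init}$ that assigns to every $\tau_{\mathrm{in}}$-database over a nonempty finite domain a $\tau_{\mathrm{aux}}$-database over the same domain; (iv) a designated query symbol $Q$, a relation symbol of $\tau_{\mathrm{aux}}$ that has the arity of the query to be maintained. The program starts on a database $\mathcal{D}$ in the state $(\mathcal{D},\mathrm{Init}(\mathcal{D}))$. When a modification $\delta(\vec a)$ is applied in a state $\mathcal{S}$, the input database is modified accordingly and, simultaneously, every auxiliary relation $R$ becomes $\{\vec b \mid \mathcal{S}\models\varphi^R_\delta(\vec a;\vec b)\}$ and every auxiliary function $f$ becomes $\vec b\mapsto t^f_\delta(\vec a;\vec b)^{\mathcal{S}}$. The program maintains a query $\mathcal{Q}$ if for every database $\mathcal{D}$ over a nonempty finite domain and every finite sequence $\alpha$ of modifications of $\mathcal{D}$, the value of $Q$ in the state reached from the initial state for $\mathcal{D}$ by applying $\alpha$ is $\mathcal{Q}(\alpha(\mathcal{D}))$.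 **Theorem.** There are a finite schema $\tau_{\mathrm{in}}$ of relation and constant symbols and a Boolean query $\mathcal{Q}$ on $\tau_{\mathrm{in}}$-databases over nonempty finite domains that is definable by an $\exists^*\forall^*$-sentence of first-order logic (a block of existential quantifiers, then a block of universal quantifiers, then a quantifier-free formula) such that no DynProp program with unary auxiliary functions maintains $\mathcal{Q}$. -/

import Mathlib

namespace DynComplexity

/-- `L` is a finite schema (finitely many relation, constant and function symbols, of arbitrary
finite relation arities) whose function symbols have arity at most `k`. Constant symbols are the
function symbols of arity `0`; so `k = 0` gives the finite relational schemas with constants, and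
`k = 1` additionally allows unary functions. -/
def IsSchema (L : FirstOrder.Language.{0, 0}) (k : ℕ) : Prop :=
  Finite L.Symbols ∧ ∀ n, k < n → IsEmpty (L.Functions n)

/-! ### Queries -/

/-- An `l`-ary query on `L`-databases: it selects a set of `l`-tuples in every `L`-structure with
a (nonempty) finite domain. A query of arity `0` is a Boolean query. -/
def Query (L : FirstOrder.Language.{0, 0}) (l : ℕ) : Type 1 :=
  ∀ (D : Type) [Finite D] [Nonempty D], L.Structure D → (Fin l → D) → Prop

/-- `∃*∀*`-formulas: a (possibly empty) block of existential quantifiers, followed by a (possibly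
empty) block of universal quantifiers, followed by a quantifier-free formula. -/
inductive IsExistsForall {L : FirstOrder.Language.{0, 0}} {α : Type} :
    ∀ {n : ℕ}, L.BoundedFormula α n → Prop
  | of_isUniversal {n : ℕ} {φ : L.BoundedFormula α n} (h : φ.IsUniversal) : IsExistsForall φ
  | ex {n : ℕ} {φ : L.BoundedFormula α (n + 1)} (h : IsExistsForall φ) : IsExistsForall φ.ex

/-- The query `q` is defined by an `∃*∀*`-formula. -/
def Query.ExistsForallDefinable {L : FirstOrder.Language.{0, 0}} {l : ℕ} (q : Query L l) : Prop :=
  ∃ φ : L.Formula (Fin l), IsExistsForall φ ∧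
    ∀ (D : Type) [Finite D] [Nonempty D] (I : L.Structure D) (c : Fin l → D),
      q D I c ↔ φ.Realize c

/-! ### Modifications of the input database -/

/-- The two kinds of modifications. -/
inductive ModKind : Type
  | ins
  | del

/-- A modification: the insertion of a tuple over `D` into, or its deletion from, a relation. -/
structure Modification (L : FirstOrder.Language.{0, 0}) (D : Type) : Type where
  kind : ModKind
  arity : ℕ
  rel : L.Relations arity
  tuple : Fin arity → D

/-- The database obtained from `I` by a modification. Only the relation `δ.rel` can change, and
only at `δ.tuple`; constants keep their values. -/
@[reducible] def Modification.apply {L : FirstOrder.Language.{0, 0}} {D : Type} (δ : Modification L D)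
    (I : L.Structure D) : L.Structure D where
  funMap := I.funMap
  RelMap {n} R b :=
    match δ.kind with
    | .ins => I.RelMap R b ∨
        (⟨n, R, b⟩ : Σ m, L.Relations m × (Fin m → D)) = ⟨δ.arity, δ.rel, δ.tuple⟩
    | .del => I.RelMap R b ∧
        (⟨n, R, b⟩ : Σ m, L.Relations m × (Fin m → D)) ≠ ⟨δ.arity, δ.rel, δ.tuple⟩

/-- The database obtained by applying a sequence of modifications, from left to right. -/
@[reducible] def applyAll {L : FirstOrder.Language.{0, 0}} {D : Type} (I : L.Structure D)
    (α : List (Modification L D)) : L.Structure D :=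
  α.foldl (fun J δ => δ.apply J) I

/-! ### Update terms and quantifier-free update formulas -/

mutual

/-- Update terms over `L` with variables in `V`: built from variables by function symbols and the
if-then-else construct, whose condition is a quantifier-free update formula. -/
inductive UpdateTerm (L : FirstOrder.Language.{0, 0}) (V : Type) : Type
  | var (x : V) : UpdateTerm L V
  | func {n : ℕ} (f : L.Functions n) (ts : Fin n → UpdateTerm L V) : UpdateTerm L V
  | ite (φ : UpdateFormula L V) (s t : UpdateTerm L V) : UpdateTerm L V

/-- Quantifier-free update formulas: Boolean combinations (through `⊥` and `→`) of equations and
relational atoms between update terms. -/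
inductive UpdateFormula (L : FirstOrder.Language.{0, 0}) (V : Type) : Type
  | falsum : UpdateFormula L V
  | equal (s t : UpdateTerm L V) : UpdateFormula L V
  | rel {n : ℕ} (R : L.Relations n) (ts : Fin n → UpdateTerm L V) : UpdateFormula L V
  | imp (φ ψ : UpdateFormula L V) : UpdateFormula L V

end

open Classical in
mutual

/-- The value of an update term in the structure `M` under the assignment `v`. -/
noncomputable def UpdateTerm.value {L : FirstOrder.Language.{0, 0}} {V D : Type} (M : L.Structure D)
    (v : V → D) : UpdateTerm L V → D
  | .var x => v x
  | .func f ts => M.funMap f (fun i => (ts i).value M v)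
  | .ite φ s t => if φ.Holds M v then s.value M v else t.value M v

/-- Truth of a quantifier-free update formula in `M` under the assignment `v`. -/
noncomputable def UpdateFormula.Holds {L : FirstOrder.Language.{0, 0}} {V D : Type} (M : L.Structure D)
    (v : V → D) : UpdateFormula L V → Prop
  | .falsum => False
  | .equal s t => s.value M v = t.value M v
  | .rel R ts => M.RelMap R (fun i => (ts i).value M v)
  | .imp φ ψ => φ.Holds M v → ψ.Holds M v

end

/-! ### Dynamic programs -/

/-- A quantifier-free update program over the dynamic schema `(Lin, Laux)`: for each kind of
modification of each input relation `S`, an update formula for every auxiliary relation symbol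
and an update term for every auxiliary function symbol. In `Fin m ⊕ Fin n`, the left variables
stand for the modified tuple, the right ones for the auxiliary tuple that is being updated. -/
structure UpdateProgram (Lin Laux : FirstOrder.Language.{0, 0}) : Type where
  relFormula (k : ModKind) {m : ℕ} (S : Lin.Relations m) {n : ℕ} (R : Laux.Relations n) :
    UpdateFormula (Lin.sum Laux) (Fin m ⊕ Fin n)
  funTerm (k : ModKind) {m : ℕ} (S : Lin.Relations m) {n : ℕ} (f : Laux.Functions n) :
    UpdateTerm (Lin.sum Laux) (Fin m ⊕ Fin n)

/-- A program state over the domain `D`: the current database and the auxiliary database. -/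
structure State (Lin Laux : FirstOrder.Language.{0, 0}) (D : Type) : Type where
  input : Lin.Structure D
  aux : Laux.Structure D

/-- A state, seen as a structure over the union of the input and the auxiliary schema. -/
@[reducible] def State.toStructure {Lin Laux : FirstOrder.Language.{0, 0}} {D : Type} (S : State Lin Laux D) :
    (Lin.sum Laux).Structure D :=
  letI := S.input
  letI := S.aux
  inferInstance

/-- One step of an update program. All update formulas and update terms are evaluated in the old
state, i.e. before the modification is applied, and all auxiliary data is updated at once. -/
noncomputable def UpdateProgram.step {Lin Laux : FirstOrder.Language.{0, 0}} {D : Type}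
    (P : UpdateProgram Lin Laux) (S : State Lin Laux D) (δ : Modification Lin D) :
    State Lin Laux D where
  input := δ.apply S.input
  aux :=
    { funMap := fun f b =>
        (P.funTerm δ.kind δ.rel f).value S.toStructure (Sum.elim δ.tuple b)
      RelMap := fun R b =>
        (P.relFormula δ.kind δ.rel R).Holds S.toStructure (Sum.elim δ.tuple b) }

/-- The state reached from `S` after a sequence of modifications. -/
noncomputable def UpdateProgram.run {Lin Laux : FirstOrder.Language.{0, 0}} {D : Type}
    (P : UpdateProgram Lin Laux) (S : State Lin Laux D) (α : List (Modification Lin D)) :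
    State Lin Laux D :=
  α.foldl P.step S

/-- A quantifier-free dynamic program with an `l`-ary query symbol: an update program, an
arbitrary initialization mapping from input databases to auxiliary databases over the same
domain, and a designated auxiliary relation symbol. -/
structure DynamicProgram (Lin Laux : FirstOrder.Language.{0, 0}) (l : ℕ) : Type 1 where
  update : UpdateProgram Lin Laux
  init : ∀ (D : Type) [Finite D] [Nonempty D], Lin.Structure D → Laux.Structure D
  querySymbol : Laux.Relations l

/-- The program maintains the query `q`: for every database `I` over a finite domain and every
modification sequence `α`, the query relation in the state reached from the initial state for `I`
through `α` is the result of `q` on the modified database. -/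
def DynamicProgram.Maintains {Lin Laux : FirstOrder.Language.{0, 0}} {l : ℕ}
    (P : DynamicProgram Lin Laux l) (q : Query Lin l) : Prop :=
  ∀ (D : Type) [Finite D] [Nonempty D] (I : Lin.Structure D) (α : List (Modification Lin D))
    (c : Fin l → D),
    (P.update.run ⟨I, P.init D I⟩ α).aux.RelMap P.querySymbol c ↔ q D (applyAll I α) c

end DynComplexity

namespace DynComplexity

open FirstOrder

/-! ### Local terms and formulas -/

section Local

variable {Lin Laux : FirstOrder.Language.{0, 0}} {ρ : ℕ} {U V A : Type}

/-- A uniform map from states and assignments to elements is `ρ`-local if there are finitely many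
unary functions such that one of them, applied to one of the variables, gives the value, and this
choice is determined by a finite colouring of the `ρ`-tuples of variables. -/
def IsLocalTerm (ρ : ℕ) (τ : ∀ D : Type, State Lin Laux D → (V → D) → D) : Prop :=
  ∃ (K W : Type) (_ : Finite K) (_ : Finite W), ∀ D : Type,
    ∃ (G : State Lin Laux D → (Fin ρ → D) → K) (h : W → State Lin Laux D → D → D),
      ∀ (S S' : State Lin Laux D) (v v' : V → D),
        (∀ i : Fin ρ → V, G S (v ∘ i) = G S' (v' ∘ i)) →
          ∃ w x, τ D S v = h w S (v x) ∧ τ D S' v' = h w S' (v' x)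

/-- A uniform property of states and assignments is `ρ`-local if it is determined by a finite
colouring of the `ρ`-tuples of variables. -/
def IsLocalFormula (ρ : ℕ) (φ : ∀ D : Type, State Lin Laux D → (V → D) → Prop) : Prop :=
  ∃ (K : Type) (_ : Finite K), ∀ D : Type,
    ∃ G : State Lin Laux D → (Fin ρ → D) → K,
      ∀ (S S' : State Lin Laux D) (v v' : V → D),
        (∀ i : Fin ρ → V, G S (v ∘ i) = G S' (v' ∘ i)) → (φ D S v ↔ φ D S' v')

theorem isLocalTerm_unary (g : ∀ D : Type, State Lin Laux D → D → D) (x : V) :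
    IsLocalTerm ρ (fun D (S : State Lin Laux D) v => g D S (v x)) :=
  ⟨Unit, Unit, inferInstance, inferInstance, fun D =>
    ⟨fun _ _ => (), fun _ S d => g D S d, fun _ _ _ _ _ => ⟨(), x, rfl, rfl⟩⟩⟩

theorem isLocalTerm_var (x : V) :
    IsLocalTerm ρ (fun D (_ : State Lin Laux D) v => v x) :=
  isLocalTerm_unary (fun _ _ d => d) x

theorem isLocalFormula_of_le {n : ℕ} (hn : n ≤ ρ) (hV : Nonempty V)
    (ψ : ∀ D : Type, State Lin Laux D → (Fin n → D) → Prop) (σ : Fin n → V) :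
    IsLocalFormula ρ (fun D S v => ψ D S (v ∘ σ)) := by
  refine ⟨Prop, inferInstance, fun D =>
    ⟨fun S u => ψ D S (u ∘ Fin.castLE hn), fun S S' v v' H => ?_⟩⟩
  obtain ⟨x⟩ := hV
  have hσ : (fun j : Fin ρ => if hj : j.1 < n then σ ⟨j, hj⟩ else x) ∘ Fin.castLE hn = σ := by
    funext j
    simp
  have := H (fun j : Fin ρ => if hj : j.1 < n then σ ⟨j, hj⟩ else x)
  simp only [Function.comp_assoc, hσ] at this
  exact iff_of_eq this

theorem isLocalFormula_false :
    IsLocalFormula ρ (fun D (_ : State Lin Laux D) (_ : V → D) => False) :=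
  ⟨Unit, inferInstance, fun _ => ⟨fun _ _ => (), fun _ _ _ _ _ => Iff.rfl⟩⟩

theorem IsLocalFormula.connective {φ ψ : ∀ D : Type, State Lin Laux D → (V → D) → Prop}
    (hφ : IsLocalFormula ρ φ) (hψ : IsLocalFormula ρ ψ) (c : Prop → Prop → Prop) :
    IsLocalFormula ρ (fun D S v => c (φ D S v) (ψ D S v)) := by
  obtain ⟨K₁, _, h₁⟩ := hφ
  obtain ⟨K₂, _, h₂⟩ := hψ
  refine ⟨K₁ × K₂, inferInstance, fun D => ?_⟩
  obtain ⟨G₁, h₁⟩ := h₁ D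
  obtain ⟨G₂, h₂⟩ := h₂ D
  refine ⟨fun S u => (G₁ S u, G₂ S u), fun S S' v v' H => ?_⟩
  change c _ _ ↔ c _ _
  rw [h₁ S S' v v' fun i => congrArg Prod.fst (H i), h₂ S S' v v' fun i => congrArg Prod.snd (H i)]

open Classical in
theorem IsLocalFormula.ite {φ : ∀ D : Type, State Lin Laux D → (V → D) → Prop}
    {s t : ∀ D : Type, State Lin Laux D → (V → D) → D}
    (hφ : IsLocalFormula ρ φ) (hs : IsLocalTerm ρ s) (ht : IsLocalTerm ρ t) :
    IsLocalTerm ρ (fun D S v => if φ D S v then s D S v else t D S v) := by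
  obtain ⟨K, _, hφ⟩ := hφ
  obtain ⟨K₁, W₁, _, _, h₁⟩ := hs
  obtain ⟨K₂, W₂, _, _, h₂⟩ := ht
  refine ⟨K × K₁ × K₂, W₁ ⊕ W₂, inferInstance, inferInstance, fun D => ?_⟩
  obtain ⟨G, hφ⟩ := hφ D
  obtain ⟨G₁, f₁, h₁⟩ := h₁ D
  obtain ⟨G₂, f₂, h₂⟩ := h₂ D
  refine ⟨fun S u => (G S u, G₁ S u, G₂ S u), Sum.elim f₁ f₂, fun S S' v v' H => ?_⟩
  have e := hφ S S' v v' fun i => congrArg Prod.fst (H i)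
  by_cases hc : φ D S v
  · obtain ⟨w, x, hw⟩ := h₁ S S' v v' fun i => congrArg (fun p => p.2.1) (H i)
    exact ⟨Sum.inl w, x, by simpa [hc, e.1 hc] using hw⟩
  · obtain ⟨w, x, hw⟩ := h₂ S S' v v' fun i => congrArg (fun p => p.2.2) (H i)
    exact ⟨Sum.inr w, x, by simpa [hc, mt e.2 hc] using hw⟩

theorem IsLocalFormula.comp [Finite U] {φ : ∀ D : Type, State Lin Laux D → (U → D) → Prop}
    {τ : U → ∀ D : Type, State Lin Laux D → (V → D) → D}
    (hφ : IsLocalFormula ρ φ) (hτ : ∀ x, IsLocalTerm ρ (τ x)) :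
    IsLocalFormula ρ (fun D S v => φ D S (fun x => τ x D S v)) := by
  obtain ⟨K, _, hφ⟩ := hφ
  choose Kτ Wτ _ _ hτ using hτ
  refine ⟨(∀ x, Kτ x) × ((Fin ρ → U) × (∀ x, Wτ x) → K), inferInstance, fun D => ?_⟩
  obtain ⟨G, hφ⟩ := hφ D
  choose Gτ f hτ using fun x => hτ x D
  refine ⟨fun S u => (fun x => Gτ x S u,
    fun p => G S (fun j => f (p.1 j) (p.2 (p.1 j)) S (u j))), fun S S' v v' H => ?_⟩
  choose w y hw hw' using fun x => hτ x S S' v v' fun i => congrFun (congrArg Prod.fst (H i)) x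
  refine hφ S S' _ _ fun i => ?_
  have := congrFun (congrArg Prod.snd (H (y ∘ i))) (i, w)
  simpa only [Function.comp_def, hw, hw'] using this

theorem IsLocalTerm.comp [Finite U] {t : ∀ D : Type, State Lin Laux D → (U → D) → D}
    {τ : U → ∀ D : Type, State Lin Laux D → (V → D) → D}
    (ht : IsLocalTerm ρ t) (hτ : ∀ x, IsLocalTerm ρ (τ x)) :
    IsLocalTerm ρ (fun D S v => t D S (fun x => τ x D S v)) := by
  obtain ⟨K, W, _, _, ht⟩ := ht
  choose Kτ Wτ _ _ hτ using hτ
  refine ⟨(∀ x, Kτ x) × ((Fin ρ → U) × (∀ x, Wτ x) → K), W × (Σ x, Wτ x),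
    inferInstance, inferInstance, fun D => ?_⟩
  obtain ⟨G, h, ht⟩ := ht D
  choose Gτ f hτ using fun x => hτ x D
  refine ⟨fun S u => (fun x => Gτ x S u,
    fun p => G S (fun j => f (p.1 j) (p.2 (p.1 j)) S (u j))),
    fun p S d => h p.1 S (f p.2.1 p.2.2 S d), fun S S' v v' H => ?_⟩
  choose w y hw hw' using fun x => hτ x S S' v v' fun i => congrFun (congrArg Prod.fst (H i)) x
  obtain ⟨w₀, x₀, e, e'⟩ := ht S S' (fun x => τ x D S v) (fun x => τ x D S' v') fun i => by
    have := congrFun (congrArg Prod.snd (H (y ∘ i))) (i, w)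
    simpa only [Function.comp_def, hw, hw'] using this
  exact ⟨(w₀, ⟨x₀, w x₀⟩), y x₀, e.trans (by rw [hw]), e'.trans (by rw [hw'])⟩

theorem IsLocalTerm.equal (hρ : 2 ≤ ρ) {s t : ∀ D : Type, State Lin Laux D → (V → D) → D}
    (hs : IsLocalTerm ρ s) (ht : IsLocalTerm ρ t) :
    IsLocalFormula ρ (fun D S v => s D S v = t D S v) := by
  have h := (isLocalFormula_of_le (Lin := Lin) (Laux := Laux) hρ ⟨(0 : Fin 2)⟩
    (fun _ _ u => u 0 = u 1) id).comp (τ := ![s, t]) (Fin.forall_fin_two.2 ⟨hs, ht⟩)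
  exact h

/-! ### Local transformations of states -/

/-- A transformation of states with parameters indexed by `A` is `ρ`-local if all relations and
functions of the new state are `ρ`-local in the old state. -/
structure IsLocalTransformation (ρ : ℕ)
    (Φ : ∀ D : Type, State Lin Laux D → (A → D) → State Lin Laux D) : Prop where
  funMap {n : ℕ} (f : (Lin.sum Laux).Functions n) :
    IsLocalTerm (V := A ⊕ Fin n) ρ
      (fun D S u => (Φ D S (u ∘ Sum.inl)).toStructure.funMap f (u ∘ Sum.inr))
  relMap {n : ℕ} (R : (Lin.sum Laux).Relations n) :
    IsLocalFormula (V := A ⊕ Fin n) ρ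
      (fun D S u => (Φ D S (u ∘ Sum.inl)).toStructure.RelMap R (u ∘ Sum.inr))

variable {Φ : ∀ D : Type, State Lin Laux D → (A → D) → State Lin Laux D}

mutual

theorem IsLocalTransformation.value [Finite A] (hρ : 2 ≤ ρ) (hΦ : IsLocalTransformation ρ Φ) :
    ∀ t : UpdateTerm (Lin.sum Laux) V, IsLocalTerm (V := A ⊕ V) ρ
      (fun D S u => t.value (Φ D S (u ∘ Sum.inl)).toStructure (u ∘ Sum.inr))
  | .var x => by
    simp only [UpdateTerm.value]
    exact isLocalTerm_var (Sum.inr x)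
  | .func f ts => by
    simp only [UpdateTerm.value]
    exact (hΦ.funMap f).comp (τ := Sum.elim (fun a _ _ u => u (Sum.inl a))
      (fun j D S u => (ts j).value (Φ D S (u ∘ Sum.inl)).toStructure (u ∘ Sum.inr)))
      (Sum.rec (fun a => isLocalTerm_var (Sum.inl a)) fun j => hΦ.value hρ (ts j))
  | .ite φ s t => by
    simp only [UpdateTerm.value]
    exact (hΦ.holds hρ φ).ite (hΦ.value hρ s) (hΦ.value hρ t)

theorem IsLocalTransformation.holds [Finite A] (hρ : 2 ≤ ρ) (hΦ : IsLocalTransformation ρ Φ) :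
    ∀ φ : UpdateFormula (Lin.sum Laux) V, IsLocalFormula (V := A ⊕ V) ρ
      (fun D S u => φ.Holds (Φ D S (u ∘ Sum.inl)).toStructure (u ∘ Sum.inr))
  | .falsum => by
    simp only [UpdateFormula.Holds]
    exact isLocalFormula_false
  | .equal s t => by
    simp only [UpdateFormula.Holds]
    exact (hΦ.value hρ s).equal hρ (hΦ.value hρ t)
  | .rel R ts => by
    simp only [UpdateFormula.Holds]
    exact (hΦ.relMap R).comp (τ := Sum.elim (fun a _ _ u => u (Sum.inl a))
      (fun j D S u => (ts j).value (Φ D S (u ∘ Sum.inl)).toStructure (u ∘ Sum.inr)))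
      (Sum.rec (fun a => isLocalTerm_var (Sum.inl a)) fun j => hΦ.value hρ (ts j))
  | .imp φ ψ => by
    simp only [UpdateFormula.Holds]
    exact (hΦ.holds hρ φ).connective (hΦ.holds hρ ψ) (fun p q => p → q)

end

theorem isLocalTransformation_id [Nonempty A]
    (hf : ∀ n, 1 < n → IsEmpty ((Lin.sum Laux).Functions n))
    (hr : ∀ n, ρ < n → IsEmpty ((Lin.sum Laux).Relations n)) :
    IsLocalTransformation (Lin := Lin) (Laux := Laux) (A := A) ρ (fun _ S _ => S) where
  funMap {n} f := by
    obtain ⟨a⟩ := ‹Nonempty A›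
    match n, f with
    | 0, f =>
      convert isLocalTerm_unary (fun D (S : State Lin Laux D) _ => S.toStructure.funMap f default)
        (Sum.inl a : A ⊕ Fin 0) using 4
      exact congrArg _ (Subsingleton.elim _ _)
    | 1, f =>
      convert isLocalTerm_unary (fun D (S : State Lin Laux D) d => S.toStructure.funMap f fun _ => d)
        (Sum.inr 0 : A ⊕ Fin 1) using 4
      refine congrArg _ (funext fun j => ?_)
      rw [Subsingleton.elim j 0]
      rfl
    | n + 2, f => exact ((hf (n + 2) (by omega)).false f).elim
  relMap {n} R :=
    isLocalFormula_of_le (not_lt.1 fun h => (hr n h).false R) inferInstance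
      (fun D (S : State Lin Laux D) u => S.toStructure.RelMap R u) Sum.inr

/-- The insertion of the tuple `b` into the relation `R`. -/
def insertion {D : Type} {n : ℕ} (R : Lin.Relations n) (b : Fin n → D) : Modification Lin D :=
  ⟨.ins, n, R, b⟩

theorem IsLocalTransformation.step [Finite A] (hρ : 2 ≤ ρ) (hf : ∀ n, IsEmpty (Lin.Functions n))
    (hΦ : IsLocalTransformation ρ Φ) (P : UpdateProgram Lin Laux) (T : Lin.Relations 1) (j : A) :
    IsLocalTransformation ρ (fun D S a => P.step (Φ D S a) (insertion T fun _ => a j)) where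
  funMap {n} f := by
    obtain f | f := f
    · exact ((hf n).false f).elim
    · convert (hΦ.value hρ (P.funTerm .ins T f)).comp
        (τ := fun x _ _ u => u (Sum.elim Sum.inl (Sum.elim (fun _ => Sum.inl j) Sum.inr) x))
        (fun x => isLocalTerm_var (V := A ⊕ Fin n) _) using 4 with D S u
      change (P.funTerm .ins T f).value _ _ = _
      congr 1
      funext x
      cases x <;> rfl
  relMap {n} R := by
    obtain R | R := R
    · have h₁ := hΦ.relMap (Sum.inl R : (Lin.sum Laux).Relations n)
      have h₂ : IsLocalFormula (V := A ⊕ Fin n) ρ (fun D (S : State Lin Laux D) u =>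
          (⟨n, R, u ∘ Sum.inr⟩ : Σ m, Lin.Relations m × (Fin m → D)) =
            ⟨1, T, fun _ => u (Sum.inl j)⟩) := by
        by_cases hn : n = 1
        · subst hn
          by_cases hR : R = T
          · subst hR
            convert isLocalFormula_of_le (Lin := Lin) (Laux := Laux) hρ inferInstance
              (fun _ _ u => u 0 = u 1) (![Sum.inr 0, Sum.inl j] : Fin 2 → A ⊕ Fin 1) using 4
            simp [funext_iff]
          · simpa [hR] using isLocalFormula_false
        · simpa [hn] using isLocalFormula_false
      exact h₁.connective h₂ (fun p q => p ∨ q)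
    · convert (hΦ.holds hρ (P.relFormula .ins T R)).comp
        (τ := fun x _ _ u => u (Sum.elim Sum.inl (Sum.elim (fun _ => Sum.inl j) Sum.inr) x))
        (fun x => isLocalTerm_var (V := A ⊕ Fin n) _) using 4 with D S u
      change (P.relFormula .ins T R).Holds _ _ ↔ _
      apply iff_of_eq
      congr 1
      funext x
      cases x <;> rfl

theorem isLocalTransformation_run [Finite A] [Nonempty A] (hρ : 2 ≤ ρ)
    (hf₀ : ∀ n, IsEmpty (Lin.Functions n))
    (hf : ∀ n, 1 < n → IsEmpty ((Lin.sum Laux).Functions n))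
    (hr : ∀ n, ρ < n → IsEmpty ((Lin.sum Laux).Relations n))
    (P : UpdateProgram Lin Laux) (T : Lin.Relations 1) (l : List A) :
    IsLocalTransformation ρ
      (fun _ S a => P.run S (l.map fun j => insertion T fun _ => a j)) := by
  induction l using List.reverseRecOn with
  | nil => exact isLocalTransformation_id hf hr
  | append_singleton l j ih =>
    simpa [UpdateProgram.run, List.foldl_append] using ih.step hρ hf₀ P T j

end Local

/-! ### The query -/

/-- The relation symbols of the input schema: a binary and a unary one. -/
inductive MarkRel : ℕ → Type
  | edge : MarkRel 2
  | mark : MarkRel 1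

/-- Directed graphs with a set of marked nodes. -/
def markLanguage : FirstOrder.Language.{0, 0} := ⟨fun _ => Empty, MarkRel⟩

theorem isSchema_markLanguage : IsSchema markLanguage 0 := by
  refine ⟨?_, fun n _ => inferInstanceAs (IsEmpty Empty)⟩
  have : Finite (Σ l, MarkRel l) := by
    refine Finite.of_surjective
      (fun b : Bool => if b then (⟨2, .edge⟩ : Σ l, MarkRel l) else ⟨1, .mark⟩) ?_
    rintro ⟨_, _ | _⟩
    · exact ⟨true, rfl⟩
    · exact ⟨false, rfl⟩
  have : IsEmpty (Σ l, markLanguage.Functions l) := ⟨fun p => Empty.elim p.2⟩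
  exact inferInstanceAs (Finite ((Σ l, markLanguage.Functions l) ⊕ Σ l, MarkRel l))

/-- The structure over the schema `markLanguage` with the given edges and marked nodes. -/
@[reducible] def markStructure {D : Type} (E : D → D → Prop) (T : D → Prop) :
    markLanguage.Structure D where
  funMap f := Empty.elim f
  RelMap {_} R :=
    match R with
    | .edge => fun b => E (b 0) (b 1)
    | .mark => fun b => T (b 0)

/-- The symbol for the set of marked nodes. -/
abbrev mark : markLanguage.Relations 1 := MarkRel.mark

/-- The symbol for the edge relation. -/
abbrev edge : markLanguage.Relations 2 := MarkRel.edge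

/-- Some node has exactly the marked nodes as its successors. -/
def successorsMarked : markLanguage.Formula (Fin 0) :=
  ((edge.boundedFormula₂ (&0) (&1)).iff (mark.boundedFormula₁ (&1)) :
    markLanguage.BoundedFormula (Fin 0) 2).all.ex

theorem isExistsForall_successorsMarked : IsExistsForall successorsMarked := by
  refine .ex (.of_isUniversal (.all (.of_isQF ?_)))
  have h₁ : (edge.boundedFormula₂ (&0) (&1) : markLanguage.BoundedFormula (Fin 0) 2).IsQF :=
    (FirstOrder.Language.BoundedFormula.IsAtomic.rel _ _).isQF
  have h₂ : (mark.boundedFormula₁ (&1) : markLanguage.BoundedFormula (Fin 0) 2).IsQF :=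
    (FirstOrder.Language.BoundedFormula.IsAtomic.rel _ _).isQF
  exact (h₁.imp h₂).inf (h₂.imp h₁)

theorem realize_successorsMarked {D : Type} [markLanguage.Structure D] (c : Fin 0 → D) :
    successorsMarked.Realize c ↔
      ∃ x : D, ∀ y : D, FirstOrder.Language.Structure.RelMap edge ![x, y] ↔
        FirstOrder.Language.Structure.RelMap mark ![y] := by
  simp only [successorsMarked, FirstOrder.Language.Formula.Realize,
    FirstOrder.Language.BoundedFormula.realize_ex, FirstOrder.Language.BoundedFormula.realize_all,
    FirstOrder.Language.BoundedFormula.realize_iff,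
    FirstOrder.Language.BoundedFormula.realize_rel₁,
    FirstOrder.Language.BoundedFormula.realize_rel₂]
  rfl

/-- The Boolean query defined by `successorsMarked`. -/
def markQuery : Query markLanguage 0 := fun _ _ _ _ c => successorsMarked.Realize c

theorem relMap_mark_applyAll {D : Type} (I : markLanguage.Structure D) (l : List D) (d : D) :
    (applyAll I (l.map fun d => insertion mark fun _ => d)).RelMap mark ![d] ↔
      I.RelMap mark ![d] ∨ d ∈ l := by
  induction l generalizing I with
  | nil => exact (or_iff_left List.not_mem_nil).symm
  | cons a l ih =>
    refine (ih _).trans ?_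
    change (_ ∨ (⟨1, mark, ![d]⟩ : Σ n, markLanguage.Relations n × (Fin n → D)) =
      ⟨1, mark, fun _ => a⟩) ∨ d ∈ l ↔ _
    rw [or_assoc]
    refine or_congr_right ?_
    simp [funext_iff]

theorem relMap_edge_applyAll {D : Type} (I : markLanguage.Structure D) (l : List D)
    (b : Fin 2 → D) :
    (applyAll I (l.map fun d => insertion mark fun _ => d)).RelMap edge b ↔ I.RelMap edge b := by
  induction l generalizing I with
  | nil => rfl
  | cons a l ih =>
    refine (ih _).trans (or_iff_left fun h => ?_)
    have : (2 : ℕ) = 1 := congrArg Sigma.fst h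
    omega

/-! ### The databases -/

section Databases

variable {m k : ℕ}

/-- The nodes: the points of an `m`-partite set, and the functions selecting one point of each
part. -/
abbrev Node (m k : ℕ) : Type := (Fin m × Fin k) ⊕ (Fin m → Fin k)

/-- Every function of the family `F` has its graph as its set of successors, and no node is
marked. -/
@[reducible] def familyDatabase (F : Set (Fin m → Fin k)) : markLanguage.Structure (Node m k) :=
  markStructure (fun x y => ∃ f ∈ F, x = Sum.inr f ∧ ∃ j, y = Sum.inl (j, f j)) fun _ => False

/-- Marking the graph of `f` node by node. -/
def markGraph (f : Fin m → Fin k) : List (Modification markLanguage (Node m k)) :=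
  (List.finRange m).map fun j => insertion mark fun _ => Sum.inl (j, f j)

theorem markQuery_applyAll_markGraph [NeZero m] [Nonempty (Node m k)] (F : Set (Fin m → Fin k))
    (f : Fin m → Fin k) (c : Fin 0 → Node m k) :
    markQuery (Node m k) (applyAll (familyDatabase F) (markGraph f)) c ↔ f ∈ F := by
  have hl : markGraph f = ((List.finRange m).map fun j => (Sum.inl (j, f j) : Node m k)).map
      fun d => insertion mark fun _ => d := by
    simp [markGraph, Function.comp_def]
  let _ := applyAll (familyDatabase F) (markGraph f)
  refine (realize_successorsMarked c).trans ?_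
  have h₁ : ∀ d : Node m k, (applyAll (familyDatabase F) (markGraph f)).RelMap mark ![d] ↔
      ∃ j, d = Sum.inl (j, f j) := by
    intro d
    rw [hl, relMap_mark_applyAll]
    refine (or_iff_right id).trans ?_
    simp [eq_comm]
  have h₂ : ∀ x y : Node m k, (applyAll (familyDatabase F) (markGraph f)).RelMap edge ![x, y] ↔
      ∃ f ∈ F, x = Sum.inr f ∧ ∃ j, y = Sum.inl (j, f j) := by
    intro x y
    rw [hl, relMap_edge_applyAll]
    rfl
  refine (exists_congr fun x => forall_congr' fun y => iff_congr (h₂ x y) (h₁ y)).trans ?_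
  constructor
  · rintro ⟨x, hx⟩
    obtain ⟨g, hg, rfl, -⟩ := (hx (Sum.inl (0, f 0))).2 ⟨0, rfl⟩
    convert hg
    funext j
    obtain ⟨g', -, e, i, hi⟩ := (hx (Sum.inl (j, f j))).2 ⟨j, rfl⟩
    cases e
    have hij := Sum.inl.inj hi
    have hj : j = i := congrArg Prod.fst hij
    subst hj
    exact congrArg Prod.snd hij
  · intro hf
    refine ⟨Sum.inr f, fun y => ⟨?_, fun hy => ⟨f, hf, rfl, hy⟩⟩⟩
    rintro ⟨g, -, e, hy⟩
    cases e
    exact hy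

end Databases

/-! ### The lower bound -/

theorem exists_pow_lt (c ρ : ℕ) : ∃ k : ℕ, 0 < k ∧ c * ((ρ + 1) ^ ρ * k ^ ρ) < k ^ (ρ + 1) := by
  refine ⟨c * (ρ + 1) ^ ρ + 1, by positivity, ?_⟩
  rw [pow_succ', ← mul_assoc]
  exact Nat.mul_lt_mul_of_pos_right (Nat.lt_succ_self _) (by positivity)

theorem exists_arity_bound {L : FirstOrder.Language.{0, 0}} (h : Finite L.Symbols) :
    ∃ r, ∀ n, r < n → IsEmpty (L.Relations n) := by
  have : Finite (Σ l, L.Relations l) :=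
    Finite.of_injective (β := L.Symbols) Sum.inr Sum.inr_injective
  obtain ⟨r, hr⟩ := (Set.finite_range (Sigma.fst : (Σ l, L.Relations l) → ℕ)).bddAbove
  exact ⟨r, fun n hn => ⟨fun R => (hr ⟨⟨n, R⟩, rfl⟩).not_gt hn⟩⟩

/-- A local formula with more than `ρ` variables cannot single out all families of functions. -/
theorem IsLocalFormula.exists_not_iff {Lin Laux : FirstOrder.Language.{0, 0}} {ρ : ℕ}
    {φ : ∀ D : Type, State Lin Laux D → (Fin (ρ + 1) → D) → Prop} (hφ : IsLocalFormula ρ φ) :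
    ∃ k : ℕ, 0 < k ∧ ∀ S : Set (Fin (ρ + 1) → Fin k) → State Lin Laux (Node (ρ + 1) k),
      ∃ F f, ¬ (φ _ (S F) (fun j => Sum.inl (j, f j)) ↔ f ∈ F) := by
  obtain ⟨K, _, hφ⟩ := hφ
  obtain ⟨k, hk, hlt⟩ := exists_pow_lt (Nat.card K) ρ
  refine ⟨k, hk, fun S => ?_⟩
  by_contra! H
  obtain ⟨G, hG⟩ := hφ (Node (ρ + 1) k)
  let type (F : Set (Fin (ρ + 1) → Fin k)) (p : (Fin ρ → Fin (ρ + 1)) × (Fin ρ → Fin k)) : K :=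
    G (S F) fun j => Sum.inl (p.1 j, p.2 j)
  have hinj : Function.Injective type := by
    intro F F' e
    ext f
    rw [← H F f, ← H F' f]
    exact hG _ _ _ _ fun i => congrFun e (i, f ∘ i)
  have hcard := Nat.card_le_card_of_injective type hinj
  have hK : Nat.card K ≤ 2 ^ Nat.card K := Nat.lt_two_pow_self.le
  simp only [Nat.card_eq_fintype_card, Fintype.card_set, Nat.card_fun, Fintype.card_fun,
    Fintype.card_fin, Fintype.card_prod] at hcard hlt
  have := hcard.trans ((Nat.pow_le_pow_left hK _).trans_eq (pow_mul _ _ _).symm)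
  exact absurd ((Nat.pow_le_pow_iff_right one_lt_two).1 this) hlt.not_ge

theorem not_maintains_markQuery {Laux : FirstOrder.Language.{0, 0}} (hL : IsSchema Laux 1)
    (P : DynamicProgram markLanguage Laux 0) : ¬ P.Maintains markQuery := by
  intro hP
  obtain ⟨r, hr⟩ := exists_arity_bound hL.1
  have hf₀ : ∀ n, IsEmpty (markLanguage.Functions n) := fun n => inferInstanceAs (IsEmpty Empty)
  have hf : ∀ n, 1 < n → IsEmpty ((markLanguage.sum Laux).Functions n) := fun n hn => by
    have := hL.2 n hn
    have := hf₀ n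
    exact inferInstanceAs (IsEmpty (_ ⊕ _))
  have hrel : ∀ n, max 2 r < n → IsEmpty ((markLanguage.sum Laux).Relations n) := fun n hn => by
    have := hr n (by omega)
    have : IsEmpty (markLanguage.Relations n) := ⟨fun R => by cases R <;> omega⟩
    exact inferInstanceAs (IsEmpty (_ ⊕ _))
  have hQ := (isLocalTransformation_run (A := Fin (max 2 r + 1)) (le_max_left 2 r) hf₀ hf hrel
    P.update mark (List.finRange _)).relMap (Sum.inr P.querySymbol)
  have hQ' := hQ.comp (V := Fin (max 2 r + 1)) (τ := fun x _ _ v => v (Sum.elim id Fin.elim0 x))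
    fun x => isLocalTerm_var _
  obtain ⟨k, hk, h⟩ := hQ'.exists_not_iff
  have : Nonempty (Node (max 2 r + 1) k) := ⟨Sum.inl (0, ⟨0, hk⟩)⟩
  obtain ⟨F, f, hne⟩ := h fun F => ⟨familyDatabase F, P.init _ (familyDatabase F)⟩
  refine hne (Iff.trans ?_ (markQuery_applyAll_markGraph F f Fin.elim0))
  refine Iff.trans (iff_of_eq ?_) (hP _ (familyDatabase F) (markGraph f) Fin.elim0)
  exact congrArg _ (Subsingleton.elim _ _)

end DynComplexity

theorem theorem6p2 :
    ∃ Lin : FirstOrder.Language.{0, 0}, DynComplexity.IsSchema Lin 0 ∧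
      ∃ q : DynComplexity.Query Lin 0, q.ExistsForallDefinable ∧
        ∀ Laux : FirstOrder.Language.{0, 0}, DynComplexity.IsSchema Laux 1 →
          ∀ P : DynComplexity.DynamicProgram Lin Laux 0, ¬ P.Maintains q :=
  ⟨DynComplexity.markLanguage, DynComplexity.isSchema_markLanguage, DynComplexity.markQuery,
    ⟨DynComplexity.successorsMarked, DynComplexity.isExistsForall_successorsMarked,
      fun _ _ _ _ _ => Iff.rfl⟩,
    fun _ hL P => DynComplexity.not_maintains_markQuery hL P⟩
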